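/- Let $X\in\mathbb{R}^{n\times p}$, let $\{I_1,\dots,I_t\}$ be a partition of $\{1,\dots,p\}$ into nonempty groups, and suppose that the groups are mutually orthogonal: $X_{I_i}^{T}X_{I_j}=0$ for $i\ne j$, where $X_{I_i}$ is the submatrix of the columns of $X$ with index in $I_i$. Let $l_i$ be the rank of $X_{I_i}$ and write $\|b\|_{X,I}=(\|X_{I_1}b_{I_1}\|_2,\dots,\|X_{I_t}b_{I_t}\|_2)^{T}$ for $b\in\mathbb{R}^p$. Let $y=X\beta+\varepsilon$ with $\beta\in\mathbb{R}^p$ fixed and $\varepsilon\sim N(0,\sigma^2 I_n)$, $\sigma>0$. Let $w_1,\dots,w_t>0$, $W=\mathrm{diag}(w_1,\dots,w_t)$, $\alpha,\gamma\in(0,1)$, and let $m\ge t$ be an integer (for instance the number of groups, $m=t$, or the number of covariates, $m=p$). For $i=1,\dots,t$ put $$\lambda_{gF}(i)=\max_{1\le j\le t}\left\{\frac{1}{w_j}F_{\chi_{l_j}}^{-1}\left(1-\frac{(\lfloor\gamma i\rfloor+1)\,\alpha}{2\,(m+\lfloor\gamma i\rfloor+1-i)}\right)\right\},$$ where $F_{\chi_l}^{-1}(q)=\inf\{x\in\mathbb{R}: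 F_{\chi_l}(x)\ge q\}$ and $F_{\chi_l}$ is the cumulative distribution function of the $\chi$ distribution with $l$ degrees of freedom ($\chi_0$ is the point mass at $0$). For $v\in[0,\infty)^t$ let $J_{\lambda_{gF}}(v)=\sum_{i=1}^{t}\lambda_{gF}(i)\,v_{(i)}$, where $v_{(1)}\ge\dots\ge v_{(t)}$ are the entries of $v$ in non-increasing order. Consider the gF-SLOPE problem $$\min_{b\in\mathbb{R}^p}\ \tfrac12\|y-Xb\|_2^2+\sigma J_{\lambda_{gF}}\big(W\|b\|_{X,I}\big).$$ (1) For every $y\in\mathbb{R}^n$ the problem has a solution, and all its solutions $\beta^{gS}$ give the same vector $\|\beta^{gS}\|_{X,I}$. (2) Let $\beta^{gS}$ be a solution for the random response $y=X\beta+\varepsilon$, let $Rg=|\{i:\|X_{I_i}\beta^{gS}_{I_i}\|_2\neq0\}|$, $Vg=|\{i:\|X_{I_i}\beta_{I_i}\|_2=0,\ \|X_{I_i}\beta^{gS}_{I_i}\|_2\ne0\}|$ and $\mathrm{gFDP}=Vg/\max\{Rg,1\}$. Then $P(\mathrm{gFDP}>\gamma)<\alpha$. -/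

import Mathlib

open MeasureTheory ProbabilityTheory

namespace GroupFSlope

noncomputable section

/-- The chi-squared distribution with `l` degrees of freedom: the law of the sum of the squares of
`l` independent standard normal variables. -/
def chiSqMeasure (l : ℕ) : Measure ℝ :=
  (Measure.pi fun _ : Fin l => gaussianReal 0 1).map fun g => ∑ i, g i ^ 2

/-- The chi distribution with `l` degrees of freedom: the law of the square root of a chi-squared
variable with `l` degrees of freedom. -/
def chiMeasure (l : ℕ) : Measure ℝ :=
  (chiSqMeasure l).map Real.sqrt

/-- The quantile function `F⁻¹(q) = inf {x : F(x) ≥ q}` of the chi distribution with `l` degrees of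
freedom, `F` being its cumulative distribution function. -/
def chiQuantile (l : ℕ) (q : ℝ) : ℝ :=
  sInf {x : ℝ | q ≤ cdf (chiMeasure l) x}

/-- The Euclidean norm of a vector. -/
def l2norm {n : ℕ} (v : Fin n → ℝ) : ℝ := ‖WithLp.toLp 2 v‖

/-- The submatrix formed by the columns with index in `S`. -/
def colSubmatrix {n p : ℕ} (X : Matrix (Fin n) (Fin p) ℝ) (S : Finset (Fin p)) :
    Matrix (Fin n) S ℝ :=
  X.submatrix id Subtype.val

/-- The vector of group norms, `i ↦ ‖X_{I_i} b_{I_i}‖₂`. -/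
def groupNorms {n p t : ℕ} (X : Matrix (Fin n) (Fin p) ℝ) (I : Fin t → Finset (Fin p))
    (b : Fin p → ℝ) : Fin t → ℝ :=
  fun i => l2norm ((colSubmatrix X (I i)).mulVec fun j : I i => b j)

/-- The sorted penalty `J_lam(v) = ∑_{i = 1}^t lam i * v_(i)`, where
`v_(1) ≥ v_(2) ≥ ⋯ ≥ v_(t)` are the entries of `v` in non-increasing order (`Tuple.sort v` sorts
them in non-decreasing order, so its argument is reversed). -/
def sortedPenalty {t : ℕ} (lam : ℕ → ℝ) (v : Fin t → ℝ) : ℝ :=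
  ∑ i : Fin t, lam ((i : ℕ) + 1) * v (Tuple.sort v (Fin.rev i))

/-- The group SLOPE objective `½ ‖y - X b‖² + σ J_lam(W ‖b‖_{X,I})`, `W = diag(w)`. -/
def groupSlopeObjective {n p t : ℕ} (X : Matrix (Fin n) (Fin p) ℝ) (I : Fin t → Finset (Fin p))
    (w : Fin t → ℝ) (σ : ℝ) (lam : ℕ → ℝ) (y : Fin n → ℝ) (b : Fin p → ℝ) : ℝ :=
  1 / 2 * l2norm (y - X.mulVec b) ^ 2
    + σ * sortedPenalty lam ((Matrix.diagonal w).mulVec (groupNorms X I b))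

/-- `b` is a solution (a global minimiser over `ℝ^p`) of the group SLOPE problem. -/
def IsGroupSlopeSolution {n p t : ℕ} (X : Matrix (Fin n) (Fin p) ℝ) (I : Fin t → Finset (Fin p))
    (w : Fin t → ℝ) (σ : ℝ) (lam : ℕ → ℝ) (y : Fin n → ℝ) (b : Fin p → ℝ) : Prop :=
  ∀ b' : Fin p → ℝ, groupSlopeObjective X I w σ lam y b ≤ groupSlopeObjective X I w σ lam y b'

/-- The gF-SLOPE sequence (for `i = 1, 2, …, t`)
`max_j (1 / w_j) F⁻¹_{χ_{l_j}} (1 - (⌊γ i⌋ + 1) α / (2 (m + ⌊γ i⌋ + 1 - i)))`,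
where `j` runs over the groups and `l_j` is the rank of `X_{I_j}`. -/
def lambdaGF {n p t : ℕ} (X : Matrix (Fin n) (Fin p) ℝ) (I : Fin t → Finset (Fin p))
    (w : Fin t → ℝ) (m : ℕ) (α γ : ℝ) (i : ℕ) : ℝ :=
  ⨆ j : Fin t, 1 / w j * chiQuantile (colSubmatrix X (I j)).rank
    (1 - ((⌊γ * i⌋₊ : ℝ) + 1) * α / (2 * ((m : ℝ) + (⌊γ * i⌋₊ : ℝ) + 1 - (i : ℝ))))

/-- The number `Rg` of groups selected by the estimate `bhat`. -/
def numSelected {n p t : ℕ} (X : Matrix (Fin n) (Fin p) ℝ) (I : Fin t → Finset (Fin p))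
    (bhat : Fin p → ℝ) : ℕ :=
  {i : Fin t | groupNorms X I bhat i ≠ 0}.ncard

/-- The number `Vg` of groups falsely selected by `bhat`, the true coefficients being `β`. -/
def numFalseSelected {n p t : ℕ} (X : Matrix (Fin n) (Fin p) ℝ) (I : Fin t → Finset (Fin p))
    (β bhat : Fin p → ℝ) : ℕ :=
  {i : Fin t | groupNorms X I β i = 0 ∧ groupNorms X I bhat i ≠ 0}.ncard

/-- The group false discovery proportion `Vg / max {Rg, 1}`. -/
def gFDP {n p t : ℕ} (X : Matrix (Fin n) (Fin p) ℝ) (I : Fin t → Finset (Fin p))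
    (β bhat : Fin p → ℝ) : ℝ :=
  (numFalseSelected X I β bhat : ℝ) / max (numSelected X I bhat : ℝ) 1

end

end GroupFSlope

namespace GroupFSlope

section SortedPenalty

variable {t : ℕ} {lam : ℕ → ℝ}

/-- The permutation listing the entries of `v` in non-increasing order. -/
noncomputable def descPerm (v : Fin t → ℝ) : Equiv.Perm (Fin t) := Fin.revPerm.trans (Tuple.sort v)

lemma antitone_comp_descPerm (v : Fin t → ℝ) : Antitone (v ∘ descPerm v) := fun _ _ h =>
  Tuple.monotone_sort v (Fin.rev_le_rev.mpr h)

lemma sortedPenalty_eq_sum_descPerm (lam : ℕ → ℝ) (v : Fin t → ℝ) :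
    sortedPenalty lam v = ∑ i : Fin t, lam ((i : ℕ) + 1) * v (descPerm v i) := rfl

lemma sum_perm_le_sortedPenalty (hlam : Antitone fun i : Fin t => lam ((i : ℕ) + 1))
    (v : Fin t → ℝ) (π : Equiv.Perm (Fin t)) :
    ∑ i : Fin t, lam ((i : ℕ) + 1) * v (π i) ≤ sortedPenalty lam v := by
  have hmv : Monovary (fun i : Fin t => lam ((i : ℕ) + 1)) (v ∘ descPerm v) := by
    intro i j hij
    rcases le_total i j with h | h
    · exact absurd (antitone_comp_descPerm v h) (not_le.mpr hij)
    · exact hlam h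
  have := hmv.sum_mul_comp_perm_le_sum_mul (σ := π.trans (descPerm v).symm)
  simpa [sortedPenalty_eq_sum_descPerm] using this

lemma continuous_sortedPenalty (hlam : Antitone fun i : Fin t => lam ((i : ℕ) + 1)) :
    Continuous (sortedPenalty (t := t) lam) := by
  have h : sortedPenalty (t := t) lam = fun v => Finset.univ.sup' Finset.univ_nonempty
      fun π : Equiv.Perm (Fin t) => ∑ i : Fin t, lam ((i : ℕ) + 1) * v (π i) := by
    funext v
    refine le_antisymm ?_ (Finset.sup'_le _ _ fun π _ => sum_perm_le_sortedPenalty hlam v π)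
    exact Finset.le_sup' (fun π : Equiv.Perm (Fin t) => ∑ i : Fin t, lam ((i : ℕ) + 1) * v (π i))
      (Finset.mem_univ (descPerm v))
  rw [h]
  exact Continuous.finset_sup'_apply _ fun π _ => by fun_prop

lemma sortedPenalty_nonneg (hpos : ∀ i : Fin t, 0 ≤ lam ((i : ℕ) + 1)) {v : Fin t → ℝ}
    (hv : ∀ i, 0 ≤ v i) : 0 ≤ sortedPenalty lam v :=
  Finset.sum_nonneg fun i _ => mul_nonneg (hpos i) (hv _)

lemma sortedPenalty_le_midpoint (hlam : Antitone fun i : Fin t => lam ((i : ℕ) + 1))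
    (hpos : ∀ i : Fin t, 0 ≤ lam ((i : ℕ) + 1)) {u v v' : Fin t → ℝ}
    (h : ∀ i, u i ≤ (v i + v' i) / 2) :
    sortedPenalty lam u ≤ (sortedPenalty lam v + sortedPenalty lam v') / 2 := by
  have h1 := sum_perm_le_sortedPenalty hlam v (descPerm u)
  have h2 := sum_perm_le_sortedPenalty hlam v' (descPerm u)
  have h3 : sortedPenalty lam u ≤ ∑ i : Fin t, (lam ((i : ℕ) + 1) * v (descPerm u i)
      + lam ((i : ℕ) + 1) * v' (descPerm u i)) / 2 := by
    rw [sortedPenalty_eq_sum_descPerm]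
    refine Finset.sum_le_sum fun i _ => ?_
    have := mul_le_mul_of_nonneg_left (h (descPerm u i)) (hpos i)
    linarith
  rw [← Finset.sum_div, Finset.sum_add_distrib] at h3
  linarith

/-- Position `r` (and later ones) of the sorted vector vanish when fewer than `r + 1` entries are
nonzero. -/
lemma apply_descPerm_eq_zero {v : Fin t → ℝ} (hv : ∀ i, 0 ≤ v i) (r : Fin t)
    (hr : (Finset.univ.filter fun i => v i ≠ 0).card ≤ r) : v (descPerm v r) = 0 := by
  by_contra hne
  have hsub : (Finset.Iic r).map (descPerm v).toEmbedding ⊆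
      Finset.univ.filter fun i => v i ≠ 0 := by
    intro j hj
    obtain ⟨k, hk, rfl⟩ := Finset.mem_map.mp hj
    have h1 := antitone_comp_descPerm v (Finset.mem_Iic.mp hk)
    have h2 : 0 < v (descPerm v r) := lt_of_le_of_ne (hv _) (Ne.symm hne)
    simpa using (lt_of_lt_of_le h2 h1).ne'
  have := Finset.card_le_card hsub
  rw [Finset.card_map, Fin.card_Iic] at this
  omega

/-- Zeroing a nonzero entry of a nonnegative vector with `r + 1` nonzero entries decreases the
sorted penalty by at least `lam (r + 1)` times that entry. -/
lemma sortedPenalty_update_zero_add_le (hlam : Antitone fun i : Fin t => lam ((i : ℕ) + 1))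
    {v : Fin t → ℝ} (hv : ∀ i, 0 ≤ v i) {i : Fin t} (hi : v i ≠ 0) {r : ℕ}
    (hr : (Finset.univ.filter fun j => v j ≠ 0).card = r) :
    sortedPenalty lam (Function.update v i 0) + lam r * v i ≤ sortedPenalty lam v := by
  set u := Function.update v i 0 with hu
  have hr0 : 0 < r := by
    rw [← hr]; exact Finset.card_pos.mpr ⟨i, by simpa using hi⟩
  have hrt : r ≤ t := by
    rw [← hr]; exact (Finset.card_le_univ _).trans (by simp)
  have hu0 : ∀ j, 0 ≤ u j := fun j => by
    by_cases h : j = i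
    · subst h; simp [hu]
    · simpa [hu, h] using hv j
  have hcard : (Finset.univ.filter fun j => u j ≠ 0).card ≤ r - 1 := by
    rw [← hr, ← Finset.card_erase_of_mem (s := Finset.univ.filter fun j => v j ≠ 0) (a := i)
      (by simpa using hi)]
    refine Finset.card_le_card fun j hj => ?_
    by_cases h : j = i
    · subst h; simp [hu] at hj
    · simpa [hu, h] using hj
  let q : Fin t := ⟨r - 1, by omega⟩
  have hq : u (descPerm u q) = 0 := apply_descPerm_eq_zero hu0 q hcard
  have hui : u i = 0 := by simp [hu]
  let π : Equiv.Perm (Fin t) := (descPerm u).trans (Equiv.swap (descPerm u q) i)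
  have hπq : π q = i := by simp [π]
  have huπ : ∀ j, u (π j) = u (descPerm u j) := by
    intro j
    change u (Equiv.swap (descPerm u q) i (descPerm u j)) = _
    rcases eq_or_ne (descPerm u j) (descPerm u q) with h | h
    · rw [h, Equiv.swap_apply_left, hui, hq]
    · rcases eq_or_ne (descPerm u j) i with h' | h'
      · rw [h', Equiv.swap_apply_right, hui, hq]
      · rw [Equiv.swap_apply_of_ne_of_ne h h']
  have h1 := sum_perm_le_sortedPenalty hlam v π
  refine le_trans (le_of_eq ?_) h1
  have hdiff : ∀ j : Fin t, lam ((j : ℕ) + 1) * v (π j) = lam ((j : ℕ) + 1) * u (descPerm u j)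
      + if j = q then lam r * v i else 0 := by
    intro j
    rw [← huπ j]
    split_ifs with h
    · have : (j : ℕ) + 1 = r := by rw [h]; simp only [q]; omega
      rw [h, hπq, hui, ← h, this]; ring
    · have : π j ≠ i := fun h' => h (π.injective (h'.trans hπq.symm))
      rw [hu, Function.update_of_ne this, add_zero]
  rw [Finset.sum_congr rfl fun j _ => hdiff j, Finset.sum_add_distrib, Finset.sum_ite_eq',
    if_pos (Finset.mem_univ _), sortedPenalty_eq_sum_descPerm]

end SortedPenalty

section Orthogonal

open scoped RealInnerProductSpace

variable {t : ℕ} {lam : ℕ → ℝ} {E B : Type*} [NormedAddCommGroup E] [InnerProductSpace ℝ E]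
  [FiniteDimensional ℝ E] [AddCommGroup B] [Module ℝ B] {G : Fin t → B →ₗ[ℝ] E}

/-- The sorted-penalty least squares objective for a design given by blocks `G i`. -/
noncomputable def blockObjective (G : Fin t → B →ₗ[ℝ] E) (w : Fin t → ℝ) (σ : ℝ) (lam : ℕ → ℝ)
    (y : E) (b : B) : ℝ :=
  1 / 2 * ‖y - ∑ i, G i b‖ ^ 2 + σ * sortedPenalty lam fun i => w i * ‖G i b‖

lemma starProjection_range_sum (hG : ∀ i j, i ≠ j → ∀ b b', ⟪G i b, G j b'⟫ = 0) (i : Fin t)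
    (b : B) : (LinearMap.range (G i)).starProjection (∑ j, G j b) = G i b := by
  rw [map_sum, Finset.sum_eq_single i]
  · exact Submodule.starProjection_eq_self_iff.mpr ⟨b, rfl⟩
  · intro j _ hj
    rw [Submodule.starProjection_apply_eq_zero_iff, Submodule.mem_orthogonal]
    rintro _ ⟨b', rfl⟩
    exact hG i j hj.symm b' b
  · simp

lemma exists_isMin_blockObjective (hG : ∀ i j, i ≠ j → ∀ b b', ⟪G i b, G j b'⟫ = 0)
    (hlam : Antitone fun i : Fin t => lam ((i : ℕ) + 1))
    (hpos : ∀ i : Fin t, 0 ≤ lam ((i : ℕ) + 1)) {w : Fin t → ℝ} (hw : ∀ i, 0 < w i) {σ : ℝ}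
    (hσ : 0 < σ) (y : E) :
    ∃ b, ∀ b', blockObjective G w σ lam y b ≤ blockObjective G w σ lam y b' := by
  let S : B →ₗ[ℝ] E := ∑ i, G i
  have hS : ∀ b, S b = ∑ i, G i b := fun b => by simp [S]
  let f : LinearMap.range S → ℝ := fun z => 1 / 2 * ‖y - z‖ ^ 2
    + σ * sortedPenalty lam fun i => w i * ‖(LinearMap.range (G i)).starProjection (z : E)‖
  have hfS : ∀ b, f ⟨S b, b, rfl⟩ = blockObjective G w σ lam y b := fun b => by
    simp only [f, blockObjective, hS, starProjection_range_sum hG]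
  have hcont : Continuous f := by
    have h1 := (continuous_sortedPenalty (t := t) hlam).comp (f := fun z : LinearMap.range S =>
      fun i => w i * ‖(LinearMap.range (G i)).starProjection (z : E)‖) (by fun_prop)
    have h2 : Continuous fun z : LinearMap.range S => 1 / 2 * ‖y - (z : E)‖ ^ 2 := by fun_prop
    exact h2.add (h1.const_mul σ)
  have hlim : Filter.Tendsto f (Filter.cocompact _) Filter.atTop := by
    have h1 : Filter.Tendsto (fun z : LinearMap.range S => ‖z‖ - ‖y‖ - 1)
        (Filter.cocompact _) Filter.atTop := by
      simpa only [sub_eq_add_neg, add_assoc] using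
        Filter.tendsto_atTop_add_const_right _ (-‖y‖ + -1) (tendsto_norm_cocompact_atTop)
    refine Filter.tendsto_atTop_mono (fun z => ?_) h1
    have h2 : 0 ≤ sortedPenalty lam
        fun i => w i * ‖(LinearMap.range (G i)).starProjection (z : E)‖ :=
      sortedPenalty_nonneg hpos fun i => mul_nonneg (hw i).le (norm_nonneg _)
    have h3 : ‖z‖ ≤ ‖y‖ + ‖y - z‖ := by
      have := norm_sub_le y (y - z)
      simpa using this
    have h4 := mul_nonneg hσ.le h2
    simp only [f]
    nlinarith [sq_nonneg (‖y - z‖ - 1)]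
  obtain ⟨⟨z, b, rfl⟩, hb⟩ := hcont.exists_forall_le hlim
  exact ⟨b, fun b' => by rw [← hfS, ← hfS]; exact hb _⟩

lemma blockObjective_minimizer_unique (hG : ∀ i j, i ≠ j → ∀ b b', ⟪G i b, G j b'⟫ = 0)
    (hlam : Antitone fun i : Fin t => lam ((i : ℕ) + 1))
    (hpos : ∀ i : Fin t, 0 ≤ lam ((i : ℕ) + 1)) {w : Fin t → ℝ} (hw : ∀ i, 0 < w i) {σ : ℝ}
    (hσ : 0 < σ) {y : E} {b b' : B}
    (hb : ∀ c, blockObjective G w σ lam y b ≤ blockObjective G w σ lam y c)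
    (hb' : ∀ c, blockObjective G w σ lam y b' ≤ blockObjective G w σ lam y c) (i : Fin t) :
    G i b = G i b' := by
  have hJ := sortedPenalty_le_midpoint hlam hpos
    (u := fun i => w i * ‖G i ((1 / 2 : ℝ) • (b + b'))‖) (v := fun i => w i * ‖G i b‖)
    (v' := fun i => w i * ‖G i b'‖) (fun i => by
      rw [map_smul, map_add, norm_smul, Real.norm_of_nonneg (by norm_num)]
      nlinarith [norm_add_le (G i b) (G i b'), hw i])
  have h1 := hb ((1 / 2 : ℝ) • (b + b'))
  have h2 := hb' ((1 / 2 : ℝ) • (b + b'))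
  have h3 := parallelogram_law_with_norm ℝ (y - ∑ i, G i b) (y - ∑ i, G i b')
  have h4 : y - ∑ i, G i ((1 / 2 : ℝ) • (b + b'))
      = (1 / 2 : ℝ) • ((y - ∑ i, G i b) + (y - ∑ i, G i b')) := by
    simp only [map_smul, map_add, ← Finset.smul_sum, Finset.sum_add_distrib]
    module
  have h5 : ‖y - ∑ i, G i ((1 / 2 : ℝ) • (b + b'))‖
      = 1 / 2 * ‖(y - ∑ i, G i b) + (y - ∑ i, G i b')‖ := by
    rw [h4, norm_smul, Real.norm_of_nonneg (by norm_num)]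
  simp only [blockObjective] at h1 h2
  rw [h5] at h1 h2
  have h6 := mul_le_mul_of_nonneg_left hJ hσ.le
  have h7 : ‖(y - ∑ i, G i b) - (y - ∑ i, G i b')‖ = 0 := by
    rw [← sq_eq_zero_iff]
    refine le_antisymm ?_ (sq_nonneg _)
    nlinarith
  have h8 : ∑ i, G i b = ∑ i, G i b' := by
    have := norm_eq_zero.mp h7
    rw [sub_sub_sub_cancel_left, sub_eq_zero] at this
    exact this.symm
  rw [← starProjection_range_sum hG i b, h8, starProjection_range_sum hG]

/-- A block selected by a minimiser with `r` selected blocks has a response component exceeding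
the `r`-th threshold. -/
lemma lt_norm_starProjection_of_selected (hG : ∀ i j, i ≠ j → ∀ b b', ⟪G i b, G j b'⟫ = 0)
    (hlam : Antitone fun i : Fin t => lam ((i : ℕ) + 1)) {w : Fin t → ℝ} (hw : ∀ i, 0 < w i)
    {σ : ℝ} (hσ : 0 < σ) {y : E} {b b' : B} {i : Fin t}
    (hb : blockObjective G w σ lam y b ≤ blockObjective G w σ lam y b')
    (hb'i : G i b' = 0) (hb'j : ∀ j, j ≠ i → G j b' = G j b) (hi : ‖G i b‖ ≠ 0) {r : ℕ}
    (hr : (Finset.univ.filter fun j => ‖G j b‖ ≠ 0).card = r) :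
    σ * (w i * lam r) < ‖(LinearMap.range (G i)).starProjection y‖ := by
  have hc : 0 < ‖G i b‖ := lt_of_le_of_ne (norm_nonneg _) (Ne.symm hi)
  have hJ := sortedPenalty_update_zero_add_le hlam (v := fun j => w j * ‖G j b‖)
    (fun j => mul_nonneg (hw j).le (norm_nonneg _)) (i := i) (mul_ne_zero (hw i).ne' hi) (r := r)
    (by rw [← hr]; congr 1; ext j; simp [(hw j).ne'])
  have hup : Function.update (fun j => w j * ‖G j b‖) i 0 = fun j => w j * ‖G j b'‖ := by
    funext j
    by_cases h : j = i
    · subst h; simp [hb'i]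
    · simp [h, hb'j j h]
  rw [hup] at hJ
  have hsum : y - ∑ j, G j b' = (y - ∑ j, G j b) + G i b := by
    have : ∑ j, G j b = (∑ j, G j b') + G i b := by
      rw [← Finset.sum_erase_add _ _ (Finset.mem_univ i),
        ← Finset.sum_erase_add _ (fun j => G j b') (Finset.mem_univ i), hb'i, add_zero]
      congr 1
      exact Finset.sum_congr rfl fun j hj => (hb'j j (Finset.ne_of_mem_erase hj)).symm
    rw [this]; abel
  have hinner : ⟪∑ j, G j b, G i b⟫ = ‖G i b‖ ^ 2 := by
    rw [sum_inner, Finset.sum_eq_single i, real_inner_self_eq_norm_sq]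
    · exact fun j _ hj => hG j i hj b b
    · simp
  have hproj : ⟪y, G i b⟫ ≤ ‖(LinearMap.range (G i)).starProjection y‖ * ‖G i b‖ := by
    have h : (LinearMap.range (G i)).starProjection (G i b) = G i b :=
      Submodule.starProjection_eq_self_iff.mpr ⟨b, rfl⟩
    calc ⟪y, G i b⟫ = ⟪(LinearMap.range (G i)).starProjection y, G i b⟫ := by
          rw [Submodule.inner_starProjection_left_eq_right, h]
      _ ≤ _ := real_inner_le_norm _ _
  simp only [blockObjective] at hb
  rw [hsum, norm_add_sq_real, inner_sub_left, hinner] at hb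
  have h6 := mul_le_mul_of_nonneg_left hJ hσ.le
  have h7 : σ * (w i * lam r) * ‖G i b‖
      < ‖(LinearMap.range (G i)).starProjection y‖ * ‖G i b‖ := by
    nlinarith [pow_pos hc 2]
  exact lt_of_mul_lt_mul_right h7 hc.le

end Orthogonal

section Gaussian

variable {E : Type*} [NormedAddCommGroup E] [InnerProductSpace ℝ E] [FiniteDimensional ℝ E]
  [MeasurableSpace E] [BorelSpace E]

instance isProbabilityMeasure_chiSqMeasure (l : ℕ) : IsProbabilityMeasure (chiSqMeasure l) :=
  Measure.isProbabilityMeasure_map (Measurable.aemeasurable (by fun_prop))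

instance isProbabilityMeasure_chiMeasure (l : ℕ) : IsProbabilityMeasure (chiMeasure l) :=
  Measure.isProbabilityMeasure_map (Measurable.aemeasurable (by fun_prop))

lemma map_norm_stdGaussian :
    (stdGaussian E).map (fun x => ‖x‖) = chiMeasure (Module.finrank ℝ E) := by
  rw [chiMeasure, chiSqMeasure, Measure.map_map (by fun_prop) (by fun_prop), stdGaussian,
    Measure.map_map (by fun_prop) (by fun_prop)]
  congr 1
  funext x
  simp only [Function.comp_apply]
  rw [← Real.sqrt_sq (norm_nonneg _), ← (stdOrthonormalBasis ℝ E).sum_sq_norm_inner_right]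
  congr 1
  refine Finset.sum_congr rfl fun i _ => ?_
  rw [(stdOrthonormalBasis ℝ E).orthonormal.inner_right_fintype, Real.norm_eq_abs, sq_abs]

lemma map_orthogonalProjectionOnto_stdGaussian (V : Submodule ℝ E) :
    (stdGaussian E).map V.orthogonalProjectionOnto = stdGaussian V := by
  have : IsProbabilityMeasure ((stdGaussian E).map V.orthogonalProjectionOnto) :=
    Measure.isProbabilityMeasure_map (by fun_prop)
  refine Measure.ext_of_charFun (funext fun u => ?_)
  rw [charFun_stdGaussian, charFun_apply, integral_map (by fun_prop) (by fun_prop),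
    show ‖u‖ = ‖(u : E)‖ from rfl, ← charFun_stdGaussian, charFun_apply]
  congr 1
  funext x
  rw [Submodule.inner_orthogonalProjectionOnto_eq_of_mem_right]

lemma map_norm_starProjection_stdGaussian (V : Submodule ℝ E) :
    (stdGaussian E).map (fun x => ‖V.starProjection x‖) = chiMeasure (Module.finrank ℝ V) := by
  rw [← map_norm_stdGaussian, ← map_orthogonalProjectionOnto_stdGaussian,
    Measure.map_map (by fun_prop) (by fun_prop)]
  rfl

lemma iIndepFun_norm_starProjection {ι : Type*} [Fintype ι] {V : ι → Submodule ℝ E}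
    (hV : ∀ i j, i ≠ j → V i ⟂ V j) :
    iIndepFun (fun i x => ‖(V i).starProjection x‖) (stdGaussian E) := by
  have hlaw : HasGaussianLaw (fun x i => (V i).orthogonalProjectionOnto x) (stdGaussian E) := by
    have : HasGaussianLaw (id : E → E) (stdGaussian E) :=
      ⟨by rw [Measure.map_id]; infer_instance⟩
    exact this.map (ContinuousLinearMap.pi fun i => (V i).orthogonalProjectionOnto)
  have hind := hlaw.iIndepFun_of_covariance_inner (X := fun i x => (V i).orthogonalProjectionOnto x)
    fun i j hij x y => by
      have h := covarianceBilin_apply_eq_cov (μ := stdGaussian E) IsGaussian.memLp_two_id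
        (x : E) (y : E)
      rw [covarianceBilin_stdGaussian] at h
      simp only [Submodule.inner_orthogonalProjectionOnto_eq_of_mem_left]
      rw [← h]
      exact (Submodule.isOrtho_iff_inner_eq.mp (hV i j hij)) x x.2 y y.2
  exact hind.comp (fun i v => ‖v‖) fun i => measurable_norm

end Gaussian

section Quantile

variable {l : ℕ} {q : ℝ}

lemma nonneg_of_le_cdf_chiMeasure (hq : 0 < q) {x : ℝ} (hx : q ≤ cdf (chiMeasure l) x) :
    0 ≤ x := by
  by_contra hneg
  rw [not_le] at hneg
  have h0 : chiMeasure l (Set.Iic x) = 0 := by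
    rw [chiMeasure, Measure.map_apply (by fun_prop) measurableSet_Iic]
    convert measure_empty (μ := chiSqMeasure l)
    ext y
    simpa using hneg.trans_le (Real.sqrt_nonneg y)
  rw [cdf_eq_real, measureReal_def, h0, ENNReal.toReal_zero] at hx
  linarith

lemma bddBelow_chiQuantile_set (hq : 0 < q) : BddBelow {x : ℝ | q ≤ cdf (chiMeasure l) x} :=
  ⟨0, fun _ hx => nonneg_of_le_cdf_chiMeasure hq hx⟩

lemma nonempty_chiQuantile_set (hq : q < 1) : {x : ℝ | q ≤ cdf (chiMeasure l) x}.Nonempty := by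
  obtain ⟨x, hx⟩ := ((tendsto_cdf_atTop (chiMeasure l)).eventually (lt_mem_nhds hq)).exists
  exact ⟨x, le_of_lt hx⟩

lemma chiQuantile_mono {q' : ℝ} (hq : 0 < q) (hqq' : q ≤ q') (hq' : q' < 1) :
    chiQuantile l q ≤ chiQuantile l q' :=
  csInf_le_csInf (bddBelow_chiQuantile_set hq) (nonempty_chiQuantile_set hq')
    fun _ hx => hqq'.trans hx

lemma chiQuantile_nonneg (hq : 0 < q) : 0 ≤ chiQuantile l q :=
  Real.sInf_nonneg fun _ hx => nonneg_of_le_cdf_chiMeasure hq hx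

lemma le_cdf_chiQuantile (hq : 0 < q) (hq' : q < 1) :
    q ≤ cdf (chiMeasure l) (chiQuantile l q) := by
  refine ge_of_tendsto (((cdf (chiMeasure l)).right_continuous (chiQuantile l q)).mono_left
    (nhdsWithin_mono _ Set.Ioi_subset_Ici_self)) ?_
  filter_upwards [self_mem_nhdsWithin] with x hx
  obtain ⟨z, hz, hzx⟩ := (csInf_lt_iff (bddBelow_chiQuantile_set hq)
    (nonempty_chiQuantile_set hq')).mp (Set.mem_Ioi.mp hx)
  exact le_trans hz ((monotone_cdf _) hzx.le)

lemma chiMeasure_Ioi_chiQuantile_le (hq : 0 < q) (hq' : q < 1) :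
    chiMeasure l (Set.Ioi (chiQuantile l q)) ≤ ENNReal.ofReal (1 - q) := by
  rw [← Set.compl_Iic, prob_compl_eq_one_sub measurableSet_Iic,
    ENNReal.ofReal_sub _ hq.le, ENNReal.ofReal_one, ← ofReal_cdf]
  exact tsub_le_tsub_left (ENNReal.ofReal_le_ofReal (le_cdf_chiQuantile hq hq')) _

end Quantile

section Simes

open scoped ENNReal

variable {Ω ι : Type*} [MeasurableSpace Ω] {μ : Measure Ω} [IsProbabilityMeasure μ] [Fintype ι]

open Classical in
/-- The largest `v ≤ N` such that at least `v` of the indices satisfy `p · v`, or `0`. -/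
noncomputable def stepUpCount (N : ℕ) (p : ι → ℕ → Prop) : ℕ :=
  Nat.findGreatest (fun v => v ≤ (Finset.univ.filter fun i => p i v).card) N

open Classical in
lemma stepUpCount_le_card (N : ℕ) (p : ι → ℕ → Prop) :
    stepUpCount N p ≤ (Finset.univ.filter fun i => p i (stepUpCount N p)).card := by
  have := Nat.findGreatest_spec (P := fun v => v ≤ (Finset.univ.filter fun i => p i v).card)
    (Nat.zero_le N) (Nat.zero_le _)
  exact this

/-- Forcing the `i`-th condition to hold does not change the step-up count when that condition
holds at the count. -/
lemma stepUpCount_update [DecidableEq ι] {N : ℕ} {p : ι → ℕ → Prop}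
    (hmono : ∀ i v v', 1 ≤ v → v ≤ v' → v' ≤ N → p i v → p i v') {i : ι}
    (h1 : 1 ≤ stepUpCount N p) (hi : p i (stepUpCount N p)) :
    stepUpCount N (Function.update p i fun _ => True) = stepUpCount N p := by
  set p' := Function.update p i fun _ => True with hp'
  have hle : ∀ j v, p j v → p' j v := by
    intro j v h
    by_cases hj : j = i
    · subst hj; simp [hp']
    · simpa [hp', hj] using h
  have hge : stepUpCount N p ≤ stepUpCount N p' := by
    refine Nat.le_findGreatest (Nat.findGreatest_le N) ((stepUpCount_le_card N p).trans ?_)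
    exact Finset.card_le_card fun j hj => by
      simp only [Finset.mem_filter, Finset.mem_univ, true_and] at hj ⊢
      exact hle j _ hj
  refine le_antisymm ?_ hge
  have hN : stepUpCount N p' ≤ N := Nat.findGreatest_le N
  refine Nat.le_findGreatest hN ((stepUpCount_le_card N p').trans ?_)
  refine Finset.card_le_card fun j hj => ?_
  simp only [Finset.mem_filter, Finset.mem_univ, true_and] at hj ⊢
  by_cases hji : j = i
  · subst hji
    exact hmono j _ _ h1 hge hN hi
  · simpa [hp', hji] using hj

/-- **Simes' inequality** for independent random variables with nested rejection regions. -/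
theorem measure_exists_le_card_le {Z : ι → Ω → ℝ} (hZ : iIndepFun Z μ)
    (hZm : ∀ i, Measurable (Z i)) {A : ι → ℕ → Set ℝ} (hA : ∀ i v, MeasurableSet (A i v))
    (hmono : ∀ i v v', 1 ≤ v → v ≤ v' → v' ≤ Fintype.card ι → A i v ⊆ A i v') {δ : ℝ≥0∞}
    (hδ : ∀ i v, 1 ≤ v → v ≤ Fintype.card ι → μ {ω | Z i ω ∈ A i v} ≤ v * δ) :
    μ {ω | ∃ v : ℕ, 1 ≤ v ∧ v ≤ {i | Z i ω ∈ A i v}.ncard} ≤ Fintype.card ι * δ := by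
  classical
  set N := Fintype.card ι
  let p : (ι → ℝ) → ι → ℕ → Prop := fun z i v => z i ∈ A i v
  let R : Ω → ℕ := fun ω => stepUpCount N (p fun i => Z i ω)
  let Q : ι → (ι → ℝ) → ℕ := fun i z => stepUpCount N (Function.update (p z) i fun _ => True)
  have hQi : ∀ i z z', (∀ j, j ≠ i → z j = z' j) → Q i z = Q i z' := by
    intro i z z' h
    have : Function.update (p z) i (fun _ => True) = Function.update (p z') i fun _ => True := by
      funext j
      by_cases hj : j = i
      · subst hj; simp
      · simp only [Function.update_of_ne hj, p, h j hj]
    simp only [Q, this]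
  have hQm : ∀ i, Measurable (Q i) := by
    intro i
    have hp : ∀ j v, MeasurableSet {z | Function.update (p z) i (fun _ => True) j v} := by
      intro j v
      by_cases hj : j = i
      · subst hj; simp
      · simp only [Function.update_of_ne hj, p]
        exact measurable_pi_apply j (hA j v)
    refine measurable_findGreatest fun v _ => ?_
    have hc : Measurable fun z : ι → ℝ =>
        (Finset.univ.filter fun j => Function.update (p z) i (fun _ => True) j v).card := by
      simp only [Finset.card_filter]
      exact Finset.measurable_sum _ fun j _ =>
        Measurable.ite (hp j v) measurable_const measurable_const
    exact hc (measurableSet_Ici (a := v))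
  have hind : ∀ i v, μ ({ω | Z i ω ∈ A i v} ∩ {ω | Q i (fun j => Z j ω) = v})
      = μ {ω | Z i ω ∈ A i v} * μ {ω | Q i (fun j => Z j ω) = v} := by
    intro i v
    have h := hZ.indepFun_finset {i} (Finset.univ.erase i) (by simp) hZm
    let ext : (↥(Finset.univ.erase i) → ℝ) → ι → ℝ := fun z j =>
      if hj : j ∈ Finset.univ.erase i then z ⟨j, hj⟩ else 0
    have hext : Measurable ext := measurable_pi_lambda _ fun j => by
      by_cases hj : j ∈ Finset.univ.erase i
      · simp only [ext, hj, dif_pos]; exact measurable_pi_apply _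
      · simp only [ext, hj, dif_neg, not_false_eq_true]; exact measurable_const
    have h' : IndepFun (Z i) (fun ω => Q i (ext fun j => Z j ω)) μ := h.comp
      (φ := fun z : ↥({i} : Finset ι) → ℝ => z ⟨i, Finset.mem_singleton_self i⟩)
      (ψ := fun z => Q i (ext z))
      (measurable_pi_apply _) ((hQm i).comp hext)
    have hQe : ∀ ω, Q i (ext fun j => Z j ω) = Q i fun j => Z j ω := fun ω =>
      hQi i _ _ fun j hj => by simp [ext, hj]
    have := indepFun_iff_measure_inter_preimage_eq_mul.mp h' (A i v) {v} (hA i v)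
      (measurableSet_singleton v)
    simpa [Set.preimage, Function.comp_def, hQe] using this
  have hEm : ∀ i v, MeasurableSet ({ω | Z i ω ∈ A i v} ∩ {ω | Q i (fun j => Z j ω) = v}) :=
    fun i v => (hZm i (hA i v)).inter
      (((hQm i).comp (measurable_pi_lambda _ hZm)) (measurableSet_singleton v))
  have hQN : ∀ i z, Q i z ≤ N := fun i z => Nat.findGreatest_le N
  let F : Ω → ℝ≥0∞ := fun ω => ∑ i, ∑ v ∈ Finset.Icc 1 N, (v : ℝ≥0∞)⁻¹ *
    ({ω | Z i ω ∈ A i v} ∩ {ω | Q i (fun j => Z j ω) = v}).indicator 1 ω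
  have hF : ∫⁻ ω, F ω ∂μ ≤ N * δ := by
    have hterm : ∀ i (v : ℕ), Measurable fun ω => (v : ℝ≥0∞)⁻¹ *
        ({ω | Z i ω ∈ A i v} ∩ {ω | Q i (fun j => Z j ω) = v}).indicator (1 : Ω → ℝ≥0∞) ω :=
      fun i v => (measurable_one.indicator (hEm i v)).const_mul _
    simp only [F]
    rw [lintegral_finsetSum _ fun i _ => Finset.measurable_sum _ fun v _ => hterm i v]
    have hone : ∀ i, ∫⁻ ω, ∑ v ∈ Finset.Icc 1 N, (v : ℝ≥0∞)⁻¹ * ({ω | Z i ω ∈ A i v} ∩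
        {ω | Q i (fun j => Z j ω) = v}).indicator 1 ω ∂μ ≤ δ := by
      intro i
      rw [lintegral_finsetSum _ fun v _ => hterm i v]
      calc _ ≤ ∑ v ∈ Finset.Icc 1 N, δ * μ {ω | Q i (fun j => Z j ω) = v} := by
            refine Finset.sum_le_sum fun v hv => ?_
            obtain ⟨hv1, hvN⟩ := Finset.mem_Icc.mp hv
            rw [lintegral_const_mul _ (measurable_one.indicator (hEm i v)),
              lintegral_indicator_one (hEm i v), hind, ← mul_assoc]
            gcongr
            calc (v : ℝ≥0∞)⁻¹ * μ {ω | Z i ω ∈ A i v} ≤ (v : ℝ≥0∞)⁻¹ * (v * δ) := by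
                  gcongr; exact hδ i v hv1 hvN
              _ = δ := by
                  rw [← mul_assoc, ENNReal.inv_mul_cancel (by simp; omega) (by simp), one_mul]
        _ = δ * ∑ v ∈ Finset.Icc 1 N, μ {ω | Q i (fun j => Z j ω) = v} := by
            rw [Finset.mul_sum]
        _ ≤ δ * 1 := by
            gcongr
            rw [← measure_biUnion_finset (f := fun v => {ω | Q i (fun j => Z j ω) = v})]
            · exact prob_le_one
            · intro v _ v' _ hvv'
              exact Set.disjoint_left.mpr fun ω h h' => hvv' (h.symm.trans h')
            · exact fun v _ =>
                ((hQm i).comp (measurable_pi_lambda _ hZm)) (measurableSet_singleton v)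
        _ = δ := mul_one _
    calc _ ≤ ∑ _i : ι, δ := Finset.sum_le_sum fun i _ => hone i
      _ = N * δ := by simp [N]
  have hsub : {ω | ∃ v : ℕ, 1 ≤ v ∧ v ≤ {i | Z i ω ∈ A i v}.ncard} ⊆ {ω | 1 ≤ F ω} := by
    rintro ω ⟨v, hv1, hv⟩
    have hcard : ∀ v, {i | Z i ω ∈ A i v}.ncard
        = (Finset.univ.filter fun i => p (fun i => Z i ω) i v).card := fun v => by
      rw [← Set.ncard_coe_finset]; simp [p]
    have hvN : v ≤ N := by
      rw [hcard] at hv; exact hv.trans (Finset.card_le_univ _)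
    have hR1 : 1 ≤ R ω := hv1.trans (Nat.le_findGreatest hvN (by rw [← hcard]; exact hv))
    have hRN : R ω ≤ N := Nat.findGreatest_le N
    have hRc := stepUpCount_le_card N (p fun i => Z i ω)
    have hQR : ∀ i, Z i ω ∈ A i (R ω) → Q i (fun j => Z j ω) = R ω := fun i hi =>
      stepUpCount_update (p := p fun i => Z i ω)
        (fun i v v' h1 h2 h3 h4 => hmono i v v' h1 h2 h3 h4) hR1 hi
    change (1 : ℝ≥0∞) ≤ F ω
    have hR0 : ((R ω : ℕ) : ℝ≥0∞) ≠ 0 := by simp; omega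
    calc (1 : ℝ≥0∞) = (R ω : ℝ≥0∞) * (R ω : ℝ≥0∞)⁻¹ :=
          (ENNReal.mul_inv_cancel hR0 (by simp)).symm
      _ ≤ ((Finset.univ.filter fun i => Z i ω ∈ A i (R ω)).card : ℝ≥0∞) * (R ω : ℝ≥0∞)⁻¹ := by
          gcongr
      _ = ∑ i, if Z i ω ∈ A i (R ω) then (R ω : ℝ≥0∞)⁻¹ else 0 := by
          rw [← Finset.sum_filter, Finset.sum_const, nsmul_eq_mul]
      _ ≤ F ω := by
          refine Finset.sum_le_sum fun i _ => ?_
          split_ifs with h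
          · have hmem : ω ∈ {ω' | Z i ω' ∈ A i (R ω)} ∩ {ω' | Q i (fun j => Z j ω') = R ω} :=
              ⟨h, hQR i h⟩
            refine le_trans ?_ (Finset.single_le_sum (fun _ _ => zero_le)
              (Finset.mem_Icc.mpr ⟨hR1, hRN⟩))
            rw [Set.indicator_of_mem hmem]
            simp
          · exact zero_le
  calc _ ≤ μ {ω | 1 ≤ F ω} := measure_mono hsub
    _ ≤ ∫⁻ ω, F ω ∂μ := by
        have := mul_meas_ge_le_lintegral₀ (μ := μ) (f := F)
          (Finset.measurable_sum _ fun i _ => Finset.measurable_sum _ fun v _ =>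
            (measurable_one.indicator (hEm i v)).const_mul _).aemeasurable 1
        simpa using this
    _ ≤ N * δ := hF

end Simes

section Thresholds

variable {n p t m : ℕ} {α γ : ℝ}

/-- The ratio `(⌊γ i⌋ + 1) / (m + ⌊γ i⌋ + 1 - i)` of the FDP step-down critical values. -/
noncomputable def fdpRatio (m : ℕ) (γ : ℝ) (i : ℕ) : ℝ :=
  ((⌊γ * i⌋₊ : ℝ) + 1) / ((m : ℝ) + (⌊γ * i⌋₊ : ℝ) + 1 - (i : ℝ))

lemma fdpRatio_pos {i : ℕ} (hi : i ≤ m) : 0 < fdpRatio m γ i := by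
  have h : (i : ℝ) ≤ m := by exact_mod_cast hi
  have hk : (0 : ℝ) ≤ (⌊γ * i⌋₊ : ℝ) := Nat.cast_nonneg _
  exact div_pos (by linarith) (by linarith)

lemma fdpRatio_le_one {i : ℕ} (hi : i ≤ m) : fdpRatio m γ i ≤ 1 := by
  have h : (i : ℝ) ≤ m := by exact_mod_cast hi
  have hk : (0 : ℝ) ≤ (⌊γ * i⌋₊ : ℝ) := Nat.cast_nonneg _
  exact div_le_one_of_le₀ (by linarith) (by linarith)

lemma fdpRatio_mono (hγ : γ ∈ Set.Ioo (0 : ℝ) 1) {i j : ℕ} (hij : i ≤ j) (hj : j ≤ m) :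
    fdpRatio m γ i ≤ fdpRatio m γ j := by
  have h : (j : ℝ) ≤ m := by exact_mod_cast hj
  have h' : (i : ℝ) ≤ j := by exact_mod_cast hij
  have h1 : (⌊γ * i⌋₊ : ℝ) ≤ (⌊γ * j⌋₊ : ℝ) := by
    exact_mod_cast Nat.floor_mono (mul_le_mul_of_nonneg_left h' hγ.1.le)
  have h2 : (⌊γ * j⌋₊ : ℝ) ≤ (⌊γ * i⌋₊ : ℝ) + (j - i) := by
    have : ⌊γ * j⌋₊ ≤ ⌊γ * i⌋₊ + (j - i) := by
      rw [← Nat.floor_add_natCast (mul_nonneg hγ.1.le (Nat.cast_nonneg i))]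
      refine Nat.floor_mono ?_
      rw [Nat.cast_sub hij]
      nlinarith [hγ.2]
    have h3 : ((⌊γ * j⌋₊ : ℕ) : ℝ) ≤ ((⌊γ * i⌋₊ + (j - i) : ℕ) : ℝ) := by exact_mod_cast this
    rwa [Nat.cast_add, Nat.cast_sub hij] at h3
  have hk : (0 : ℝ) ≤ (⌊γ * i⌋₊ : ℝ) := Nat.cast_nonneg _
  exact div_le_div₀ (by linarith) (by linarith) (by linarith) (by linarith)

/-- The combinatorial bound linking the critical ratio after `R` selections, `V` of them false, to
the Simes ratio `V / N` for `N` true nulls. -/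
lemma fdpRatio_le_div {t R V N : ℕ} (hm : t ≤ m) (hV : ⌊γ * R⌋₊ + 1 ≤ V) (hVN : V ≤ N)
    (hR : R + N ≤ V + t) : fdpRatio m γ R ≤ V / N := by
  have e1 : (t : ℝ) ≤ m := by exact_mod_cast hm
  have e2 : (⌊γ * R⌋₊ : ℝ) + 1 ≤ V := by exact_mod_cast hV
  have e3 : (V : ℝ) ≤ N := by exact_mod_cast hVN
  have e4 : (R : ℝ) + N ≤ V + t := by exact_mod_cast hR
  have hk : (0 : ℝ) ≤ (⌊γ * R⌋₊ : ℝ) := Nat.cast_nonneg _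
  rw [fdpRatio, div_le_div_iff₀ (by linarith) (by linarith)]
  nlinarith [mul_nonneg (sub_nonneg.mpr e2) (sub_nonneg.mpr e3),
    mul_nonneg (show (0 : ℝ) ≤ V by linarith) (show 0 ≤ (m : ℝ) + V - N - R by linarith)]

lemma lambdaGF_eq (X : Matrix (Fin n) (Fin p) ℝ) (I : Fin t → Finset (Fin p)) (w : Fin t → ℝ)
    (i : ℕ) : lambdaGF X I w m α γ i = ⨆ j : Fin t, 1 / w j *
      chiQuantile (colSubmatrix X (I j)).rank (1 - fdpRatio m γ i * α / 2) := by
  have : ((⌊γ * i⌋₊ : ℝ) + 1) * α / (2 * ((m : ℝ) + (⌊γ * i⌋₊ : ℝ) + 1 - (i : ℝ)))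
      = fdpRatio m γ i * α / 2 := by
    rw [fdpRatio, div_mul_eq_mul_div, div_div, mul_comm (2 : ℝ)]
  simp only [lambdaGF, this]

lemma mul_lambdaGF_ge (X : Matrix (Fin n) (Fin p) ℝ) (I : Fin t → Finset (Fin p))
    {w : Fin t → ℝ} (hw : ∀ i, 0 < w i) (i : ℕ) (j : Fin t) :
    chiQuantile (colSubmatrix X (I j)).rank (1 - fdpRatio m γ i * α / 2)
      ≤ w j * lambdaGF X I w m α γ i := by
  rw [lambdaGF_eq]
  have := le_ciSup (f := fun j : Fin t => 1 / w j *
    chiQuantile (colSubmatrix X (I j)).rank (1 - fdpRatio m γ i * α / 2))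
    (Set.finite_range _).bddAbove j
  have h := mul_le_mul_of_nonneg_left this (hw j).le
  rwa [← mul_assoc, mul_one_div_cancel (hw j).ne', one_mul] at h

variable (X : Matrix (Fin n) (Fin p) ℝ) (I : Fin t → Finset (Fin p)) {w : Fin t → ℝ}

lemma level_mem_Ioo (hα : α ∈ Set.Ioo (0 : ℝ) 1) {x : ℝ} (hx : 0 < x) (hx' : x ≤ 1) :
    1 - x * α / 2 ∈ Set.Ioo (0 : ℝ) 1 := by
  constructor <;> nlinarith [hα.1, hα.2, mul_pos hx hα.1]

lemma lambdaGF_nonneg (hw : ∀ i, 0 < w i) (hα : α ∈ Set.Ioo (0 : ℝ) 1) {i : ℕ} (hi : i ≤ m) :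
    0 ≤ lambdaGF X I w m α γ i := by
  rw [lambdaGF_eq]
  exact Real.iSup_nonneg fun j => mul_nonneg (one_div_nonneg.mpr (hw j).le)
    (chiQuantile_nonneg (level_mem_Ioo hα (fdpRatio_pos hi) (fdpRatio_le_one hi)).1)

lemma lambdaGF_antitone (hw : ∀ i, 0 < w i) (hm : t ≤ m) (hα : α ∈ Set.Ioo (0 : ℝ) 1)
    (hγ : γ ∈ Set.Ioo (0 : ℝ) 1) :
    Antitone fun i : Fin t => lambdaGF X I w m α γ ((i : ℕ) + 1) := by
  intro i j hij
  have hi : (i : ℕ) + 1 ≤ m := by omega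
  have hj : (j : ℕ) + 1 ≤ m := by omega
  have hij' : (i : ℕ) + 1 ≤ j + 1 := Nat.succ_le_succ hij
  simp only [lambdaGF_eq]
  refine ciSup_mono (Set.finite_range _).bddAbove fun k => ?_
  refine mul_le_mul_of_nonneg_left ?_ (one_div_nonneg.mpr (hw k).le)
  refine chiQuantile_mono (level_mem_Ioo hα (fdpRatio_pos hj) (fdpRatio_le_one hj)).1 ?_
    (level_mem_Ioo hα (fdpRatio_pos hi) (fdpRatio_le_one hi)).2
  have := mul_le_mul_of_nonneg_right (fdpRatio_mono hγ hij' hj) hα.1.le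
  linarith

end Thresholds

section Design

variable {n p t : ℕ} (X : Matrix (Fin n) (Fin p) ℝ) (I : Fin t → Finset (Fin p))

/-- The linear map `b ↦ X_{I_i} b_{I_i}` into Euclidean space. -/
noncomputable def groupPart (i : Fin t) : (Fin p → ℝ) →ₗ[ℝ] EuclideanSpace ℝ (Fin n) :=
  (WithLp.linearEquiv 2 ℝ (Fin n → ℝ)).symm.toLinearMap ∘ₗ
    (colSubmatrix X (I i)).mulVecLin ∘ₗ LinearMap.funLeft ℝ ℝ Subtype.val

lemma groupPart_apply (i : Fin t) (b : Fin p → ℝ) :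
    groupPart X I i b = WithLp.toLp 2 ((colSubmatrix X (I i)).mulVec fun j : I i => b j) := rfl

lemma groupNorms_eq_norm_groupPart (b : Fin p → ℝ) (i : Fin t) :
    groupNorms X I b i = ‖groupPart X I i b‖ := rfl

lemma finrank_range_groupPart (i : Fin t) :
    Module.finrank ℝ (LinearMap.range (groupPart X I i)) = (colSubmatrix X (I i)).rank := by
  have hsurj : Function.Surjective (LinearMap.funLeft ℝ ℝ (Subtype.val : I i → Fin p)) :=
    LinearMap.funLeft_surjective_of_injective _ _ _ Subtype.val_injective
  rw [groupPart, LinearMap.range_comp, LinearMap.range_comp_of_range_eq_top _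
    (LinearMap.range_eq_top.mpr hsurj), Matrix.rank]
  exact LinearEquiv.finrank_map_eq _ _

variable {X I}

lemma inner_groupPart_eq_zero (hX : ∀ i j, i ≠ j →
    (colSubmatrix X (I i)).transpose * colSubmatrix X (I j) = 0) (i j : Fin t) (hij : i ≠ j)
    (b b' : Fin p → ℝ) : inner ℝ (groupPart X I i b) (groupPart X I j b') = 0 := by
  rw [groupPart_apply, groupPart_apply, EuclideanSpace.inner_toLp_toLp, star_trivial,
    dotProduct_comm, Matrix.dotProduct_mulVec, Matrix.vecMul_mulVec, hX i j hij,
    Matrix.vecMul_zero, zero_dotProduct]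

lemma sum_groupPart (hI_disjoint : ∀ i j, i ≠ j → Disjoint (I i) (I j))
    (hI_cover : ∀ a : Fin p, ∃ i, a ∈ I i) (b : Fin p → ℝ) :
    ∑ i, groupPart X I i b = WithLp.toLp 2 (X.mulVec b) := by
  ext k
  simp only [groupPart_apply, WithLp.ofLp_sum, Finset.sum_apply, Matrix.mulVec, dotProduct,
    colSubmatrix, Matrix.submatrix_apply, id]
  have hu : (Finset.univ : Finset (Fin p)) = Finset.univ.biUnion I := by
    ext a; simpa using hI_cover a
  rw [hu, Finset.sum_biUnion fun i _ j _ hij => hI_disjoint i j hij]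
  exact Finset.sum_congr rfl fun i _ => Finset.sum_coe_sort (I i) fun a => X k a * b a

lemma groupSlopeObjective_eq_blockObjective
    (hI_disjoint : ∀ i j, i ≠ j → Disjoint (I i) (I j))
    (hI_cover : ∀ a : Fin p, ∃ i, a ∈ I i) (w : Fin t → ℝ) (σ : ℝ) (lam : ℕ → ℝ)
    (y : Fin n → ℝ) (b : Fin p → ℝ) :
    groupSlopeObjective X I w σ lam y b
      = blockObjective (groupPart X I) w σ lam (WithLp.toLp 2 y) b := by
  have : (Matrix.diagonal w).mulVec (groupNorms X I b) = fun i => w i * ‖groupPart X I i b‖ := by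
    funext i
    rw [Matrix.mulVec_diagonal, groupNorms_eq_norm_groupPart]
  rw [groupSlopeObjective, blockObjective, this, sum_groupPart hI_disjoint hI_cover, l2norm,
    WithLp.toLp_sub]

/-- The vector obtained from `b` by zeroing the coordinates of one group. -/
lemma exists_groupPart_eq_zero (hI_disjoint : ∀ i j, i ≠ j → Disjoint (I i) (I j)) (i : Fin t)
    (b : Fin p → ℝ) :
    ∃ b', groupPart X I i b' = 0 ∧ ∀ j, j ≠ i → groupPart X I j b' = groupPart X I j b := by
  refine ⟨fun a => if a ∈ I i then 0 else b a, ?_, fun j hj => ?_⟩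
  · have : (fun a : I i => if (a : Fin p) ∈ I i then (0 : ℝ) else b a) = 0 := by
      funext a; simp
    rw [groupPart_apply, this, Matrix.mulVec_zero]; rfl
  · have : (fun a : I j => if (a : Fin p) ∈ I i then (0 : ℝ) else b a) = fun a : I j => b a := by
      funext a
      rw [if_neg (Finset.disjoint_left.mp (hI_disjoint j i hj) a.2)]
    rw [groupPart_apply, this, groupPart_apply]

/-- If the false discovery proportion exceeds `γ`, then the null groups violate one of the Simes
bounds. -/
lemma exists_simes_violation_of_lt_gFDP
    (hI_disjoint : ∀ i j, i ≠ j → Disjoint (I i) (I j))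
    (hI_cover : ∀ a : Fin p, ∃ i, a ∈ I i)
    (hX : ∀ i j, i ≠ j → (colSubmatrix X (I i)).transpose * colSubmatrix X (I j) = 0)
    {w : Fin t → ℝ} (hw : ∀ i, 0 < w i) {m : ℕ} (hm : t ≤ m) {α γ σ : ℝ}
    (hα : α ∈ Set.Ioo (0 : ℝ) 1) (hγ : γ ∈ Set.Ioo (0 : ℝ) 1) (hσ : 0 < σ)
    {β bhat : Fin p → ℝ} {e : Fin n → ℝ}
    (hb : IsGroupSlopeSolution X I w σ (lambdaGF X I w m α γ) (X.mulVec β + e) bhat)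
    (hfdp : γ < gFDP X I β bhat) :
    ∃ v : ℕ, 1 ≤ v ∧ v ≤ {i : {i : Fin t // groupNorms X I β i = 0} |
      ‖(LinearMap.range (groupPart X I i)).starProjection (WithLp.toLp 2 (σ⁻¹ • e))‖ ∈
        Set.Ioi (chiQuantile (colSubmatrix X (I i)).rank
          (1 - v / Nat.card {i : Fin t // groupNorms X I β i = 0} * α / 2))}.ncard := by
  classical
  set H := {i : Fin t // groupNorms X I β i = 0}
  set N := Nat.card H with hN
  set R := numSelected X I bhat with hR
  set V := numFalseSelected X I β bhat with hV
  have hG := inner_groupPart_eq_zero hX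
  let Sel : Finset (Fin t) := Finset.univ.filter fun i => groupNorms X I bhat i ≠ 0
  let Nul : Finset (Fin t) := Finset.univ.filter fun i => groupNorms X I β i = 0
  have hRS : R = Sel.card := by
    rw [hR, numSelected, ← Set.ncard_coe_finset]; simp [Sel]
  have hVS : V = (Nul ∩ Sel).card := by
    rw [hV, numFalseSelected, ← Set.ncard_coe_finset]
    congr 1; ext i; simp [Sel, Nul]
  have hNS : N = Nul.card := by
    rw [hN, Nat.card_eq_fintype_card, Fintype.card_subtype]
  have hVN : V ≤ N := by
    rw [hVS, hNS]; exact Finset.card_le_card Finset.inter_subset_left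
  have hRN : R + N ≤ V + t := by
    have h1 := Finset.card_union_add_card_inter Nul Sel
    have h2 : (Nul ∪ Sel).card ≤ t := (Finset.card_le_univ _).trans (by simp)
    omega
  have hRt : R ≤ t := by rw [hRS]; exact (Finset.card_le_univ _).trans (by simp)
  have hVR : γ * R < V := by
    have h := (lt_div_iff₀ (lt_of_lt_of_le one_pos (le_max_right _ _))).mp hfdp
    exact lt_of_le_of_lt (mul_le_mul_of_nonneg_left (le_max_left _ _) hγ.1.le) h
  have hkV : ⌊γ * R⌋₊ + 1 ≤ V := by
    refine Nat.succ_le_of_lt ((Nat.floor_lt (mul_nonneg hγ.1.le (Nat.cast_nonneg _))).mpr hVR)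
  have hV1 : 1 ≤ V := by omega
  have hratio : fdpRatio m γ R ≤ V / N := fdpRatio_le_div hm hkV hVN hRN
  have hNpos : (0 : ℝ) < N := by exact_mod_cast (show 0 < N by omega)
  have hVN1 : (V : ℝ) / N ≤ 1 := div_le_one_of_le₀ (by exact_mod_cast hVN) hNpos.le
  refine ⟨V, hV1, ?_⟩
  have hsel : ∀ i ∈ Nul ∩ Sel,
      chiQuantile (colSubmatrix X (I i)).rank (1 - V / N * α / 2) <
      ‖(LinearMap.range (groupPart X I i)).starProjection (WithLp.toLp 2 (σ⁻¹ • e))‖ := by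
    intro i hi
    have hi0 : groupNorms X I β i = 0 := (Finset.mem_filter.mp (Finset.mem_inter.mp hi).1).2
    have hi1 : groupNorms X I bhat i ≠ 0 := (Finset.mem_filter.mp (Finset.mem_inter.mp hi).2).2
    obtain ⟨b', hb'i, hb'j⟩ := exists_groupPart_eq_zero (X := X) hI_disjoint i bhat
    have hle := hb b'
    rw [groupSlopeObjective_eq_blockObjective hI_disjoint hI_cover,
      groupSlopeObjective_eq_blockObjective hI_disjoint hI_cover] at hle
    have hlt := lt_norm_starProjection_of_selected hG (lambdaGF_antitone X I hw hm hα hγ) hw hσ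
      hle hb'i hb'j hi1 (r := R) hRS.symm
    rw [WithLp.toLp_add, map_add, ← sum_groupPart hI_disjoint hI_cover,
      starProjection_range_sum hG,
      show groupPart X I i β = 0 from norm_eq_zero.mp hi0, zero_add] at hlt
    have h1 := mul_lambdaGF_ge (m := m) (α := α) (γ := γ) X I hw R i
    have h2 : chiQuantile (colSubmatrix X (I i)).rank (1 - V / N * α / 2)
        ≤ chiQuantile (colSubmatrix X (I i)).rank (1 - fdpRatio m γ R * α / 2) := by
      refine chiQuantile_mono
        (level_mem_Ioo hα ((fdpRatio_pos (hRt.trans hm)).trans_le hratio) hVN1).1 ?_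
        (level_mem_Ioo hα (fdpRatio_pos (hRt.trans hm)) (fdpRatio_le_one (hRt.trans hm))).2
      have := mul_le_mul_of_nonneg_right hratio hα.1.le
      linarith
    rw [WithLp.toLp_smul, map_smul, norm_smul, norm_inv, Real.norm_of_nonneg hσ.le,
      inv_mul_eq_div, lt_div_iff₀ hσ, mul_comm]
    exact lt_of_le_of_lt (mul_le_mul_of_nonneg_left (h2.trans h1) hσ.le) hlt
  refine (hVS.trans (Set.ncard_coe_finset _).symm).le.trans ?_
  rw [← Set.ncard_image_of_injective _ Subtype.val_injective]
  refine Set.ncard_le_ncard (fun i hi => ?_) (Set.toFinite _)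
  have hi0 : groupNorms X I β i = 0 := (Finset.mem_filter.mp (Finset.mem_inter.mp hi).1).2
  exact ⟨⟨i, hi0⟩, hsel i hi, rfl⟩

end Design

section Noise

lemma hasLaw_stdGaussian_of_noise {Ω : Type*} [MeasurableSpace Ω] {P : Measure Ω} {n : ℕ} {σ : ℝ}
    (hσ : 0 < σ) {v : NNReal} (hv : (v : ℝ) = σ ^ 2) {ε : Ω → Fin n → ℝ}
    (hε : HasLaw ε (Measure.pi fun _ : Fin n => gaussianReal 0 v) P) :
    HasLaw (fun ω => WithLp.toLp 2 (σ⁻¹ • ε ω)) (stdGaussian (EuclideanSpace ℝ (Fin n))) P := by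
  have h : HasLaw (fun x : Fin n → ℝ => WithLp.toLp 2 (σ⁻¹ • x))
      (stdGaussian (EuclideanSpace ℝ (Fin n)))
      (Measure.pi fun _ : Fin n => gaussianReal 0 v) := by
    refine ⟨by fun_prop, ?_⟩
    have hone : (gaussianReal 0 v).map (fun x => σ⁻¹ * x)
        = gaussianReal 0 1 := by
      rw [gaussianReal_map_const_mul, mul_zero]
      congr 1
      ext
      simp [hv, hσ.ne']
    have : IsProbabilityMeasure
        ((gaussianReal 0 v).map (fun x => σ⁻¹ * x)) := by
      rw [hone]; infer_instance
    have hpi := Measure.pi_map_pi (ι := Fin n)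
      (μ := fun _ => gaussianReal 0 v) (f := fun _ x => σ⁻¹ * x)
      (fun _ => by fun_prop)
    rw [← map_pi_eq_stdGaussian, ← hone, ← hpi, Measure.map_map (by fun_prop) (by fun_prop)]
    rfl
  exact h.comp hε

end Noise

end GroupFSlope

theorem mainTheorem4 {Ω : Type*} [MeasurableSpace Ω] (P : Measure Ω) [IsProbabilityMeasure P]
    {n p t : ℕ} (X : Matrix (Fin n) (Fin p) ℝ) (I : Fin t → Finset (Fin p))
    (hI_nonempty : ∀ i, (I i).Nonempty)
    (hI_disjoint : ∀ i j, i ≠ j → Disjoint (I i) (I j))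
    (hI_cover : ∀ a : Fin p, ∃ i, a ∈ I i)
    (hX : ∀ i j, i ≠ j →
      (GroupFSlope.colSubmatrix X (I i)).transpose * GroupFSlope.colSubmatrix X (I j) = 0)
    (w : Fin t → ℝ) (hw : ∀ i, 0 < w i)
    (m : ℕ) (hm : t ≤ m)
    (α γ σ : ℝ) (hα : α ∈ Set.Ioo (0 : ℝ) 1) (hγ : γ ∈ Set.Ioo (0 : ℝ) 1) (hσ : 0 < σ)
    (β : Fin p → ℝ) (ε : Ω → Fin n → ℝ)
    (hε : HasLaw ε (Measure.pi fun _ : Fin n => gaussianReal 0 ⟨σ ^ 2, sq_nonneg σ⟩) P) :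
    (∀ y : Fin n → ℝ,
      (∃ b, GroupFSlope.IsGroupSlopeSolution X I w σ
        (GroupFSlope.lambdaGF X I w m α γ) y b) ∧
      ∀ b b' : Fin p → ℝ,
        GroupFSlope.IsGroupSlopeSolution X I w σ (GroupFSlope.lambdaGF X I w m α γ) y b →
        GroupFSlope.IsGroupSlopeSolution X I w σ (GroupFSlope.lambdaGF X I w m α γ) y b' →
        GroupFSlope.groupNorms X I b = GroupFSlope.groupNorms X I b') ∧
    ∀ βgS : Ω → Fin p → ℝ,
      (∀ ω, GroupFSlope.IsGroupSlopeSolution X I w σ (GroupFSlope.lambdaGF X I w m α γ)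
        (X.mulVec β + ε ω) (βgS ω)) →
      P {ω | γ < GroupFSlope.gFDP X I β (βgS ω)} < ENNReal.ofReal α := by
  classical
  have hG := GroupFSlope.inner_groupPart_eq_zero hX
  have hanti := GroupFSlope.lambdaGF_antitone X I hw hm hα hγ
  have hpos : ∀ i : Fin t, 0 ≤ GroupFSlope.lambdaGF X I w m α γ ((i : ℕ) + 1) := fun i =>
    GroupFSlope.lambdaGF_nonneg X I hw hα (by omega)
  have hobj := GroupFSlope.groupSlopeObjective_eq_blockObjective (X := X) hI_disjoint hI_cover
  refine ⟨fun y => ⟨?_, fun b b' hb hb' => ?_⟩, fun βgS hsol => ?_⟩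
  · simpa only [GroupFSlope.IsGroupSlopeSolution, hobj] using
      GroupFSlope.exists_isMin_blockObjective hG hanti hpos hw hσ (WithLp.toLp 2 y)
  · simp only [GroupFSlope.IsGroupSlopeSolution, hobj] at hb hb'
    funext i
    rw [GroupFSlope.groupNorms_eq_norm_groupPart, GroupFSlope.groupNorms_eq_norm_groupPart,
      GroupFSlope.blockObjective_minimizer_unique hG hanti hpos hw hσ hb hb' i]
  set H := {i : Fin t // GroupFSlope.groupNorms X I β i = 0}
  have hV : ∀ i j : Fin t, i ≠ j → LinearMap.range (GroupFSlope.groupPart X I i) ⟂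
      LinearMap.range (GroupFSlope.groupPart X I j) := by
    intro i j hij
    rw [Submodule.isOrtho_iff_inner_eq]
    rintro _ ⟨b, rfl⟩ _ ⟨b', rfl⟩
    exact hG i j hij b b'
  have hlevel : ∀ v : ℕ, 1 ≤ v → v ≤ Fintype.card H →
      1 - v / Nat.card H * α / 2 ∈ Set.Ioo (0 : ℝ) 1 := by
    intro v h1 h2
    rw [Nat.card_eq_fintype_card]
    have h1' : (0 : ℝ) < v := by exact_mod_cast h1
    have h2' : (v : ℝ) ≤ Fintype.card H := by exact_mod_cast h2
    exact GroupFSlope.level_mem_Ioo hα (div_pos h1' (h1'.trans_le h2'))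
      (div_le_one_of_le₀ h2' (h1'.le.trans h2'))
  have hind := (GroupFSlope.iIndepFun_norm_starProjection hV).precomp
    (Subtype.val_injective (p := fun i => GroupFSlope.groupNorms X I β i = 0))
  have hsimes := GroupFSlope.measure_exists_le_card_le hind (fun i => by fun_prop)
    (A := fun i v => Set.Ioi (GroupFSlope.chiQuantile
      (GroupFSlope.colSubmatrix X (I i)).rank (1 - v / Nat.card H * α / 2)))
    (fun i v => measurableSet_Ioi)
    (fun i v v' h1 h2 h3 => Set.Ioi_subset_Ioi (GroupFSlope.chiQuantile_mono
      (hlevel v' (h1.trans h2) h3).1 (by gcongr; exact hα.1.le) (hlevel v h1 (h2.trans h3)).2))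
    (δ := ENNReal.ofReal (α / (2 * Nat.card H)))
    (fun i v h1 h2 => by
      have hmap := GroupFSlope.map_norm_starProjection_stdGaussian
        (LinearMap.range (GroupFSlope.groupPart X I i))
      rw [GroupFSlope.finrank_range_groupPart] at hmap
      have hl := hlevel v h1 h2
      have hchi := GroupFSlope.chiMeasure_Ioi_chiQuantile_le
        (l := (GroupFSlope.colSubmatrix X (I i)).rank) hl.1 hl.2
      rw [← hmap, Measure.map_apply (by fun_prop) measurableSet_Ioi] at hchi
      refine hchi.trans (le_of_eq ?_)
      rw [← ENNReal.ofReal_natCast, ← ENNReal.ofReal_mul (Nat.cast_nonneg _)]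
      congr 1
      rw [sub_sub_cancel, div_mul_eq_mul_div, div_div, mul_div_assoc, mul_comm (2 : ℝ)])
  have hlaw := GroupFSlope.hasLaw_stdGaussian_of_noise hσ rfl hε
  have hbound : (Fintype.card H : ENNReal) * ENNReal.ofReal (α / (2 * Nat.card H))
      ≤ ENNReal.ofReal (α / 2) := by
    rw [Nat.card_eq_fintype_card, ← ENNReal.ofReal_natCast,
      ← ENNReal.ofReal_mul (Nat.cast_nonneg _)]
    refine ENNReal.ofReal_le_ofReal ?_
    rcases eq_or_ne (Fintype.card H : ℝ) 0 with h | h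
    · rw [h, zero_mul]; linarith [hα.1]
    · exact le_of_eq (by field_simp)
  refine lt_of_le_of_lt ?_ ((ENNReal.ofReal_lt_ofReal_iff hα.1).mpr (half_lt_self hα.1))
  refine le_trans (measure_mono fun ω hω => ?_)
    ((Measure.le_map_apply hlaw.aemeasurable _).trans ((hlaw.map_eq ▸ hsimes).trans hbound))
  exact GroupFSlope.exists_simes_violation_of_lt_gFDP hI_disjoint hI_cover hX hw hm hα hγ hσ
    (hsol ω) hω
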